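/- All topological spaces and topological groups are Hausdorff. A network of a space $X$ is a family $\mathcal N$ of subsets of $X$ such that for every open set $U\subseteq X$ and every $x\in U$ there is $A\in\mathcal N$ with $x\in A\subseteq U$. A $G_{\delta,\Sigma}$-set is the union of a family of $G_\delta$-sets. A zero-set in $X$ is a set of the form $f^{-1}(0)$ with $f\colon X\to\mathbb R$ continuous. A space $X$ is $\omega$-cellular if every family $\gamma$ of $G_\delta$-sets in $X$ contains a countable subfamily $\lambda$ such that $\bigcup\lambda$ is dense in $\bigcup\gamma$, and $X$ is an Efimov space if the closure of every $G_{\delta,\Sigma}$-set in $X$ is a $G_\delta$-set. A topological group $G$ is $\mathbb R$-factorizable if for every continuous function $f\colon G\to\mathbb R$ there are a second-countable topological group $S$, a continuous homomorphism $\pi\colon G\to S$ and a continuous function $h\colon S\to\mathbb R$ with $f=h\circ\pi$. **Theorem.** Let $G$ be a topological group and let $K$ be a compact invariant (that is, normal) subgroup of $G$ such that the quotient group $G/K$ is homeomorphic, as a space, to a product $C\times\prod_{i\in I}H_i$, where $C$ is a compact topological group, $I$ is an arbitrary index set and each $H_i$ is a topological group with a countable network. Then $G$ is $\mathbb R$-factorizable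 and $\omega$-cellular, and the closure of every $G_{\delta,\Sigma}$-set in $G$ is a zero-set; consequently $G$ is an Efimov space. -/

import Mathlib

universe u

/-- A *network* of a space: a family of (arbitrary) subsets such that every open set is a union of
members of the family. The space has a countable network if such a countable family exists. -/
def HasCountableNetwork (X : Type*) [TopologicalSpace X] : Prop :=
  ∃ N : Set (Set X), N.Countable ∧
    ∀ (x : X) (U : Set X), IsOpen U → x ∈ U → ∃ A ∈ N, x ∈ A ∧ A ⊆ U

/-- A `G_{δ,Σ}`-set: the union of a family of `G_δ`-sets. -/
def IsGdeltaSigma {X : Type*} [TopologicalSpace X] (P : Set X) : Prop :=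
  ∃ F : Set (Set X), (∀ A ∈ F, IsGδ A) ∧ P = ⋃₀ F

/-- A zero-set: the preimage of `0` under a continuous real-valued function. -/
def IsZeroSet {X : Type*} [TopologicalSpace X] (Z : Set X) : Prop :=
  ∃ f : X → ℝ, Continuous f ∧ Z = f ⁻¹' {0}

/-- `ω`-cellular space: every family of `G_δ`-sets contains a countable subfamily whose union is
dense in the union of the whole family. -/
def IsOmegaCellular (X : Type*) [TopologicalSpace X] : Prop :=
  ∀ F : Set (Set X), (∀ A ∈ F, IsGδ A) →
    ∃ L ⊆ F, L.Countable ∧ ⋃₀ F ⊆ closure (⋃₀ L)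

/-- Efimov space: the closure of every `G_{δ,Σ}`-set is a `G_δ`-set. -/
def IsEfimov (X : Type*) [TopologicalSpace X] : Prop :=
  ∀ P : Set X, IsGdeltaSigma P → IsGδ (closure P)

/-- `ℝ`-factorizable topological group: every continuous real-valued function factors through a
continuous homomorphism to a second-countable (Hausdorff) topological group `S`.
Taking `S` in the universe of `G` loses nothing, since `S` can be replaced by the image of `G`,
which is a quotient of the group `G` with a suitable topology. -/
def IsRFactorizable (G : Type u) [Group G] [TopologicalSpace G] : Prop :=
  ∀ f : G → ℝ, Continuous f →
    ∃ (S : Type u) (_ : Group S) (_ : TopologicalSpace S) (π : G →* S) (h : S → ℝ),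
      IsTopologicalGroup S ∧ T2Space S ∧ SecondCountableTopology S ∧
        Continuous π ∧ Continuous h ∧ f = h ∘ π

/-!
The proof studies a topological group `G` through the open quotient maps `G → G ⧸ L` onto groups
with a countable network. A family of normal subgroups `L` of this kind is called a lattice
(`IsCosmicLattice`) if every `G_δ`-set containing the identity contains one of its members, and the
intersection of a decreasing sequence of members is a member whose quotient has the topology
generated by the quotients of the sequence.

A group with a lattice has all the required properties. Given a family of `G_δ`-sets, a closing-off
argument yields a decreasing sequence of members `L n` and countably many points `d` of the union of
the family, dense modulo each `L n`, such that the coset of `d` by the intersection `L` of the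
sequence lies in a chosen member of the family containing `d`. As the quotient map by `L` is open,
these countably many members of the family are dense in its union, and the closure of the union is a
union of cosets of `L` (`IsCosmicLattice.exists_mul_subset_closure`). Hence `G` is `ω`-cellular, and
closures of `G_{δ,Σ}`-sets are preimages of closed subsets of spaces with a countable network, where
closed sets are zero-sets. A continuous real function is constant on the cosets of some `L`, since
the closures of its sublevel sets are unions of such cosets; it thus factors through `G ⧸ L`, which
is `ℝ`-factorizable because it is `ω`-narrow and hereditarily Lindelöf (`IsNarrow.isRFactorizable`,
which rests on Guran's theorem `IsNarrow.exists_hom`).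

It remains to find a lattice on `G`. The product of the `H i` has one, given by the countable sets
of coordinates (`isCosmicLattice_pi`). The existence of a lattice depends only on the space
underlying the group (`IsCosmicLattice.of_homeomorph`), and passes from `G ⧸ K` to `G` when `K` is
compact (`IsCosmicLattice.of_quotient`). These two facts lead from `∏ i, H i`, viewed as a quotient
of `C × ∏ i, H i`, to `C × ∏ i, H i`, from there to `G ⧸ K`, and finally to `G`.
-/

open Set Filter Topology Pointwise

/-! ### Spaces with a countable network -/

theorem HasCountableNetwork.hereditarilyLindelofSpace {X : Type*} [TopologicalSpace X]
    (hX : HasCountableNetwork X) : HereditarilyLindelofSpace X := by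
  obtain ⟨N, hN, h⟩ := hX
  refine ⟨fun s _ => isLindelof_of_countable_subcover fun {ι} U hU hs => ?_⟩
  have : Countable N := hN.to_subtype
  let M : Set N := {A | ∃ i, (A : Set X) ⊆ U i}
  choose c hc using fun A : M => A.2
  refine ⟨range c, countable_range c, fun x hx => ?_⟩
  obtain ⟨i, hi⟩ := mem_iUnion.1 (hs hx)
  obtain ⟨A, hA, hxA, hAU⟩ := h x (U i) (hU i) hi
  have hM : (⟨A, hA⟩ : N) ∈ M := ⟨i, hAU⟩
  exact mem_biUnion (mem_range_self ⟨_, hM⟩) (hc ⟨_, hM⟩ hxA)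

theorem HasCountableNetwork.perfectlyNormalSpace {X : Type*} [TopologicalSpace X] [RegularSpace X]
    (hX : HasCountableNetwork X) : PerfectlyNormalSpace X := by
  have := hX.hereditarilyLindelofSpace
  refine ⟨fun s hs => ?_⟩
  have key : ∀ x : (sᶜ : Set X), ∃ U : Set X, IsOpen U ∧ (x : X) ∈ U ∧ closure U ⊆ sᶜ := by
    intro x
    obtain ⟨V, hV, hVc, hVs⟩ := exists_mem_nhds_isClosed_subset (hs.isOpen_compl.mem_nhds x.2)
    exact ⟨interior V, isOpen_interior, mem_interior_iff_mem_nhds.2 hV,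
      (hVc.closure_subset_iff.2 interior_subset).trans hVs⟩
  choose U hUo hxU hUs using key
  obtain ⟨t, ht, hcov⟩ := (HereditarilyLindelofSpace.isLindelof sᶜ).elim_countable_subcover U hUo
    (fun x hx => mem_iUnion.2 ⟨⟨x, hx⟩, hxU _⟩)
  have hs' : s = ⋂ i ∈ t, (closure (U i))ᶜ := by
    refine Subset.antisymm (fun x hx => mem_iInter₂.2 fun i _ hi => hUs i hi hx) fun x hx => ?_
    by_contra hxs
    obtain ⟨i, hi, hxi⟩ := mem_iUnion₂.1 (hcov hxs)
    exact mem_iInter₂.1 hx i hi (subset_closure hxi)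
  rw [hs']
  exact IsGδ.biInter ht fun i _ => isClosed_closure.isOpen_compl.isGδ

theorem IsClosed.isZeroSet {X : Type*} [TopologicalSpace X] [RegularSpace X]
    (hX : HasCountableNetwork X) {s : Set X} (hs : IsClosed s) : IsZeroSet s := by
  obtain ⟨f, hf, -⟩ := perfectlyNormalSpace_iff_forall_isClosed_preimage_zero.1
    hX.perfectlyNormalSpace s hs
  exact ⟨f, f.continuous, hf⟩

/-! ### Narrow groups -/

/-- A topological group is `ω`-narrow if countably many translates of every neighbourhood of the
identity cover it. -/
def IsNarrow (G : Type*) [Group G] [TopologicalSpace G] : Prop :=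
  ∀ U ∈ 𝓝 (1 : G), ∃ D : Set G, D.Countable ∧ D * U = univ

section narrow

variable {G : Type u} [Group G] [TopologicalSpace G]

theorem IsNarrow.of_surjective {H : Type*} [Group H] [TopologicalSpace H] (hG : IsNarrow G)
    (φ : G →* H) (hφ : Continuous φ) (hs : Function.Surjective φ) : IsNarrow H := by
  intro U hU
  obtain ⟨D, hD, hDU⟩ := hG (φ ⁻¹' U) (hφ.tendsto' 1 1 (map_one φ) hU)
  refine ⟨φ '' D, hD.image φ, eq_univ_of_forall fun y => ?_⟩
  obtain ⟨x, rfl⟩ := hs y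
  obtain ⟨d, hd, v, hv, rfl⟩ := hDU.ge (mem_univ x)
  exact ⟨φ d, mem_image_of_mem φ hd, φ v, hv, (map_mul φ d v).symm⟩

/-- A narrow group is second countable as soon as it is first countable. -/
theorem IsNarrow.secondCountableTopology [IsTopologicalGroup G] (hG : IsNarrow G)
    [(𝓝 (1 : G)).IsCountablyGenerated] :
    SecondCountableTopology G := by
  obtain ⟨V, hV⟩ := (nhds_basis_opens (1 : G)).exists_antitone_subbasis
  have hmem : ∀ n, V n ∈ 𝓝 (1 : G) := fun n => (hV.1 n).2.mem_nhds (hV.1 n).1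
  choose D hD hDV using fun n => hG (V n) (hmem n)
  refine TopologicalSpace.IsTopologicalBasis.secondCountableTopology
    (b := ⋃ n, (fun d => d • V n) '' D n) ?_ (countable_iUnion fun n => (hD n).image _)
  refine TopologicalSpace.isTopologicalBasis_of_isOpen_of_nhds ?_ ?_
  · intro s hs
    obtain ⟨n, d, -, rfl⟩ := mem_iUnion.1 hs
    exact (hV.1 n).2.smul d
  · intro x U hx hU
    have h1 : Tendsto (fun p : G × G => x * (p.1⁻¹ * p.2)) (𝓝 1 ×ˢ 𝓝 1) (𝓝 x) := by
      rw [← nhds_prod_eq]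
      exact Continuous.tendsto' (by fun_prop) _ _ (by simp)
    obtain ⟨n, hn⟩ := (hV.2.prod_self.tendsto_left_iff).1 h1 U (hU.mem_nhds hx)
    obtain ⟨d, hd, v, hv, hdv⟩ := (hDV n).ge (mem_univ x)
    refine ⟨d • V n, mem_iUnion.2 ⟨n, mem_image_of_mem _ hd⟩, ⟨v, hv, hdv⟩, ?_⟩
    rintro _ ⟨w, hw, rfl⟩
    have := hn.2 (show (v, w) ∈ V n ×ˢ V n from ⟨hv, hw⟩)
    have e : d = x * v⁻¹ := by rw [← hdv]; group
    simpa [e, mul_assoc] using this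

theorem IsNarrow.exists_hom_of_isCountablyGenerated [IsTopologicalGroup G]
    (hG : IsNarrow G) (hc : (𝓝 (1 : G)).IsCountablyGenerated) :
    ∃ (S : Type u) (_ : Group S) (_ : TopologicalSpace S) (φ : G →* S),
      IsTopologicalGroup S ∧ T2Space S ∧ SecondCountableTopology S ∧ Continuous φ ∧
        ∀ U ∈ 𝓝 (1 : G), ∃ O ∈ 𝓝 (1 : S), φ ⁻¹' O ⊆ U := by
  have := hG.secondCountableTopology
  refine ⟨SeparationQuotient G, inferInstance, inferInstance, SeparationQuotient.mkMonoidHom,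
    inferInstance, inferInstance, ?_, SeparationQuotient.continuous_mk, fun U hU => ?_⟩
  · exact SeparationQuotient.isQuotientMap_mk.secondCountableTopology
      SeparationQuotient.isOpenMap_mk
  · obtain ⟨s, hsU, hs, h1⟩ := mem_nhds_iff.1 hU
    refine ⟨SeparationQuotient.mk '' s, ?_, ?_⟩
    · exact SeparationQuotient.isOpenMap_mk.image_mem_nhds (hs.mem_nhds h1)
    · intro x hx
      obtain ⟨y, hy, hxy⟩ := hx
      exact hsU (((SeparationQuotient.mk_eq_mk.1 hxy).mem_open_iff hs).1 hy)

/-- In a narrow group, every neighbourhood `U` of the identity has a square root `V` and countably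
many conjugates of `V` such that each element of the group conjugates one of them into `U`. -/
theorem IsNarrow.exists_conj [IsTopologicalGroup G] (hG : IsNarrow G) (U : Set G)
    (hU : U ∈ 𝓝 (1 : G)) :
    ∃ V : ℕ → Set G, (∀ n, V n ∈ 𝓝 (1 : G)) ∧ V 0 * V 0 ⊆ U ∧ (V 0)⁻¹ ⊆ U ∧
      ∀ x, ∃ n, ∀ y ∈ V n, x * y * x⁻¹ ∈ U := by
  have h1 : Tendsto (fun p : G × G × G => p.1 * p.2.1 * p.2.2⁻¹) (𝓝 1 ×ˢ 𝓝 1 ×ˢ 𝓝 1) (𝓝 1) := by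
    rw [← nhds_prod_eq, ← nhds_prod_eq]
    exact Continuous.tendsto' (by fun_prop) _ _ (by simp)
  have hb := (𝓝 (1 : G)).basis_sets
  obtain ⟨⟨A, B, C⟩, ⟨hA, hB, hC⟩, hABC⟩ := ((hb.prod (hb.prod hb)).tendsto_left_iff).1 h1 U hU
  set W := A ∩ (B ∩ C) with hW
  have hWn : W ∈ 𝓝 (1 : G) := inter_mem hA (inter_mem hB hC)
  have hWU : ∀ a ∈ W, ∀ b ∈ W, ∀ c ∈ W, a * b * c⁻¹ ∈ U := fun a ha b hb c hc =>
    hABC (show (a, b, c) ∈ A ×ˢ B ×ˢ C from ⟨ha.1, hb.2.1, hc.2.2⟩)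
  have h1W : (1 : G) ∈ W := mem_of_mem_nhds hWn
  obtain ⟨D, hD, hDW⟩ := hG W⁻¹ (inv_mem_nhds_one G hWn)
  obtain ⟨d, rfl⟩ := hD.exists_eq_range (s := D) <| by
    obtain ⟨d, hd, -⟩ := hDW.ge (mem_univ 1)
    exact ⟨d, hd⟩
  -- `x⁻¹ = d w⁻¹` gives `x y x⁻¹ = w (d⁻¹ y d) w⁻¹`.
  refine ⟨fun n => Nat.casesOn n W fun k => {y | (d k)⁻¹ * y * d k ∈ W}, ?_, ?_, ?_, ?_⟩
  · rintro (_ | k)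
    · exact hWn
    · have : Tendsto (fun y => (d k)⁻¹ * y * d k) (𝓝 1) (𝓝 1) :=
        Continuous.tendsto' (by fun_prop) _ _ (by simp)
      exact this hWn
  · rintro _ ⟨a, ha, b, hb, rfl⟩
    simpa using hWU a ha b hb 1 h1W
  · intro a ha
    simpa using hWU 1 h1W 1 h1W _ ha
  · intro x
    obtain ⟨_, ⟨k, rfl⟩, w, hw, h⟩ := hDW.ge (mem_univ x⁻¹)
    refine ⟨k + 1, fun y hy => ?_⟩
    have hx : x = w⁻¹ * (d k)⁻¹ := by rw [← inv_inv x, ← h]; simp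
    have := hWU w⁻¹ hw _ hy _ hw
    convert this using 1
    rw [hx]
    group

/-- The local form of Guran's theorem that a narrow Hausdorff group embeds in a product of second
countable groups. Countably many neighbourhoods of the identity, generated from `U` by
`IsNarrow.exists_conj`, form a base of a coarser group topology, and `S` is the Hausdorff quotient
of the group with this topology. -/
theorem IsNarrow.exists_hom [IsTopologicalGroup G] (hG : IsNarrow G) (U : Set G)
    (hU : U ∈ 𝓝 (1 : G)) :
    ∃ (S : Type u) (_ : Group S) (_ : TopologicalSpace S) (φ : G →* S),
      IsTopologicalGroup S ∧ T2Space S ∧ SecondCountableTopology S ∧ Continuous φ ∧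
        ∃ O ∈ 𝓝 (1 : S), φ ⁻¹' O ⊆ U := by
  have hstep : ∀ W : {W : Set G // W ∈ 𝓝 (1 : G)}, ∃ V : ℕ → {W : Set G // W ∈ 𝓝 (1 : G)},
      (V 0 : Set G) * V 0 ⊆ W ∧ (V 0 : Set G)⁻¹ ⊆ W ∧
        ∀ x, ∃ n, ∀ y ∈ (V n : Set G), x * y * x⁻¹ ∈ (W : Set G) := by
    rintro ⟨W, hW⟩
    obtain ⟨V, h1, h2, h3, h4⟩ := hG.exists_conj W hW
    exact ⟨fun n => ⟨V n, h1 n⟩, h2, h3, h4⟩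
  choose op hmul hinv hconj using hstep
  -- The countable family of neighbourhoods generated from `U` by the operations `op · n`.
  let W : List ℕ → {W : Set G // W ∈ 𝓝 (1 : G)} := fun l => l.foldr (fun n W => op W n) ⟨U, hU⟩
  let B : Finset (List ℕ) → Set G := fun F => ⋂ l ∈ F, (W l : Set G)
  have hB : ∀ F, B F ∈ 𝓝 (1 : G) := fun F => (Filter.biInter_finset_mem F).2 fun l _ => (W l).2
  have hBW : ∀ {F : Finset (List ℕ)} {l}, l ∈ F → B F ⊆ W l := fun hl => biInter_subset_of_mem hl
  classical
  let b : GroupFilterBasis G :=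
    { sets := range B
      nonempty := range_nonempty B
      inter_sets := by
        rintro _ _ ⟨F, rfl⟩ ⟨F', rfl⟩
        refine ⟨_, mem_range_self (F ∪ F'), subset_inter ?_ ?_⟩
        · exact biInter_subset_biInter_left fun l hl => Finset.mem_union_left _ hl
        · exact biInter_subset_biInter_left fun l hl => Finset.mem_union_right _ hl
      one' := by
        rintro _ ⟨F, rfl⟩
        exact mem_of_mem_nhds (hB F)
      mul' := by
        rintro _ ⟨F, rfl⟩
        refine ⟨_, mem_range_self (F.image (List.cons 0)), ?_⟩
        refine subset_iInter₂ fun l hl => ?_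
        have := hBW (Finset.mem_image_of_mem (List.cons 0) hl)
        exact (mul_subset_mul this this).trans (hmul (W l))
      inv' := by
        rintro _ ⟨F, rfl⟩
        refine ⟨_, mem_range_self (F.image (List.cons 0)), fun x hx => ?_⟩
        refine mem_iInter₂.2 fun l hl => ?_
        have := hBW (Finset.mem_image_of_mem (List.cons 0) hl) hx
        exact hinv (W l) (Set.inv_mem_inv.2 this)
      conj' := by
        rintro x _ ⟨F, rfl⟩
        choose n hn using fun l => hconj (W l) x
        refine ⟨_, mem_range_self (F.image fun l => n l :: l), fun y hy => ?_⟩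
        refine mem_iInter₂.2 fun l hl => ?_
        exact hn l y (hBW (Finset.mem_image_of_mem (fun l => n l :: l) hl) hy) }
  have hbas := b.nhds_one_hasBasis
  have hle : ∀ s, s ∈ @nhds G b.topology 1 → s ∈ 𝓝 (1 : G) := by
    intro s hs
    obtain ⟨_, ⟨F, rfl⟩, hF⟩ := hbas.mem_iff.1 hs
    exact mem_of_superset (hB F) hF
  have hU' : U ∈ @nhds G b.topology 1 :=
    hbas.mem_iff.2 ⟨_, mem_range_self {[]}, hBW (Finset.mem_singleton_self [])⟩
  have hcont : ∀ (s : Set G), @IsOpen G b.topology s → IsOpen s := by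
    intro s hs
    refine isOpen_iff_mem_nhds.2 fun x hx => ?_
    have h1 := (b.nhds_hasBasis x).mem_iff.1 (@IsOpen.mem_nhds G b.topology x s hs hx)
    obtain ⟨_, ⟨F, rfl⟩, hF⟩ := h1
    exact mem_of_superset ((smul_mem_nhds_self (g := x)).2 (hB F)) hF
  have hnar : @IsNarrow G _ b.topology := fun s hs => hG s (hle s hs)
  have hcg : (@nhds G b.topology 1).IsCountablyGenerated :=
    Filter.HasCountableBasis.isCountablyGenerated (p := fun V => V ∈ b) (s := id)
      ⟨hbas, countable_range B⟩
  obtain ⟨S, iS, tS, φ, hS, hS2, hSc, hφ, h⟩ :=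
    @IsNarrow.exists_hom_of_isCountablyGenerated G _ b.topology b.isTopologicalGroup hnar hcg
  exact ⟨S, iS, tS, φ, hS, hS2, hSc,
    ⟨fun s hs => hcont _ ((@continuous_def G S b.topology tS φ).1 hφ s hs)⟩, h U hU'⟩

end narrow

/-! ### Kernels of homomorphisms to second countable groups -/

/-- `N` is the kernel of a continuous homomorphism from `G` to a second countable Hausdorff
group. -/
def IsSecondCountableKernel {G : Type u} [Group G] [TopologicalSpace G] (N : Subgroup G) : Prop :=
  ∃ (S : Type u) (_ : Group S) (_ : TopologicalSpace S) (φ : G →* S),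
    IsTopologicalGroup S ∧ T2Space S ∧ SecondCountableTopology S ∧ Continuous φ ∧ φ.ker = N

section kernels

variable {G : Type u} [Group G] [TopologicalSpace G]

namespace IsSecondCountableKernel

variable {N : Subgroup G}

theorem normal (hN : IsSecondCountableKernel N) : N.Normal := by
  obtain ⟨S, _, _, φ, _, _, _, hφ, rfl⟩ := hN
  infer_instance

theorem isClosed (hN : IsSecondCountableKernel N) : IsClosed (N : Set G) := by
  obtain ⟨S, _, _, φ, _, _, _, hφ, rfl⟩ := hN
  exact isClosed_singleton.preimage hφ

theorem isGδ (hN : IsSecondCountableKernel N) : IsGδ (N : Set G) := by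
  obtain ⟨S, _, _, φ, _, _, _, hφ, rfl⟩ := hN
  exact (IsGδ.singleton (1 : S)).preimage (f := φ) hφ

theorem iInf {N : ℕ → Subgroup G} (hN : ∀ n, IsSecondCountableKernel (N n)) :
    IsSecondCountableKernel (⨅ n, N n) := by
  choose S i1 i2 φ i3 i4 i5 hφ hker using hN
  refine ⟨∀ n, S n, inferInstance, inferInstance, MonoidHom.mk' (fun x n => φ n x) ?_,
    inferInstance, inferInstance, inferInstance, continuous_pi hφ, ?_⟩
  · intro x y
    funext n
    simp
  · ext x
    simp [MonoidHom.mem_ker, funext_iff, Subgroup.mem_iInf, ← hker]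

/-- The image of the kernel of `φ : G → S` in the quotient by a compact normal subgroup `K` is the
kernel of the induced homomorphism to the quotient of `φ(G)` by `φ(K)`. -/
theorem map_mk (hN : IsSecondCountableKernel N) (K : Subgroup G) [K.Normal]
    (hK : IsCompact (K : Set G)) : IsSecondCountableKernel (N.map (QuotientGroup.mk' K)) := by
  obtain ⟨S, _, _, φ, _, _, _, hφ, rfl⟩ := hN
  have hφ' : Continuous φ.rangeRestrict := hφ.subtype_mk _
  let K' : Subgroup φ.range := K.map φ.rangeRestrict
  have : K'.Normal := Subgroup.Normal.map inferInstance _ φ.rangeRestrict_surjective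
  have hK' : IsClosed (K' : Set φ.range) := (hK.image hφ').isClosed
  have : SecondCountableTopology φ.range :=
    TopologicalSpace.Subtype.secondCountableTopology (φ.range : Set S)
  have hle : K ≤ ((QuotientGroup.mk' K').comp φ.rangeRestrict).ker := by
    intro k hk
    rw [MonoidHom.mem_ker, MonoidHom.comp_apply, QuotientGroup.mk'_apply, QuotientGroup.eq_one_iff]
    exact ⟨k, hk, rfl⟩
  refine ⟨φ.range ⧸ K', inferInstance, inferInstance, QuotientGroup.lift K _ hle, inferInstance,
    inferInstance, inferInstance, ?_, ?_⟩
  · exact (QuotientGroup.continuous_mk.comp hφ').quotient_lift _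
  · ext q
    obtain ⟨x, rfl⟩ := QuotientGroup.mk_surjective q
    rw [MonoidHom.mem_ker, QuotientGroup.lift_mk, MonoidHom.comp_apply, QuotientGroup.mk'_apply,
      QuotientGroup.eq_one_iff]
    constructor
    · rintro ⟨k, hk, hkx⟩
      have hkx' : φ k = φ x := congrArg Subtype.val hkx
      refine ⟨x * k⁻¹, ?_, ?_⟩
      · simp [MonoidHom.mem_ker, hkx']
      · simpa using hk
    · rintro ⟨y, hy, hyx⟩
      have hyx' : y⁻¹ * x ∈ K := QuotientGroup.eq.1 hyx
      refine ⟨_, hyx', Subtype.ext ?_⟩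
      have hy' : φ y = 1 := hy
      simp [hy']

end IsSecondCountableKernel

theorem IsNarrow.exists_isSecondCountableKernel_subset [IsTopologicalGroup G] (hG : IsNarrow G)
    {P : Set G} (hP : IsGδ P) (h1 : 1 ∈ P) :
    ∃ N : Subgroup G, IsSecondCountableKernel N ∧ (N : Set G) ⊆ P := by
  obtain ⟨U, hU, rfl⟩ := isGδ_iff_eq_iInter_nat.1 hP
  choose S i1 i2 φ i3 i4 i5 hφ O hO hOU using fun n =>
    hG.exists_hom (U n) ((hU n).mem_nhds (mem_iInter.1 h1 n))
  refine ⟨⨅ n, (φ n).ker, .iInf fun n => ⟨S n, i1 n, i2 n, φ n, i3 n, i4 n, i5 n, hφ n, rfl⟩, ?_⟩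
  intro x hx
  refine mem_iInter.2 fun n => hOU n ?_
  have : φ n x = 1 := (Subgroup.mem_iInf.1 hx) n
  rw [mem_preimage, this]
  exact mem_of_mem_nhds (hO n)

/-- Preimages of open sets under homomorphisms to second countable groups form a base of a narrow
group. In the presence of a countable network, every open set is a countable union of these, hence
itself such a preimage. -/
theorem IsNarrow.isRFactorizable [IsTopologicalGroup G] (hG : IsNarrow G)
    (hN : HasCountableNetwork G) : IsRFactorizable G := by
  have := hN.hereditarilyLindelofSpace
  intro f hf
  have hopen : ∀ V : Set G, IsOpen V → ∃ (S : Type u) (_ : Group S) (_ : TopologicalSpace S)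
      (φ : G →* S), IsTopologicalGroup S ∧ T2Space S ∧ SecondCountableTopology S ∧ Continuous φ ∧
        ∃ O, IsOpen O ∧ V = φ ⁻¹' O := by
    intro V hV
    have hpt : ∀ x : V, ∃ (S : Type u) (_ : Group S) (_ : TopologicalSpace S)
        (φ : G →* S), IsTopologicalGroup S ∧ T2Space S ∧ SecondCountableTopology S ∧ Continuous φ ∧
          ∃ O, IsOpen O ∧ φ x ∈ O ∧ φ ⁻¹' O ⊆ V := by
      intro x
      have h1 : (fun y => (x : G) * y) ⁻¹' V ∈ 𝓝 (1 : G) :=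
        (hV.preimage (continuous_const_mul _)).mem_nhds (by simp)
      obtain ⟨S, i1, i2, φ, i3, i4, i5, hφ, O, hO, hOV⟩ := hG.exists_hom _ h1
      obtain ⟨O', hO'O, hO', h1O'⟩ := mem_nhds_iff.1 hO
      refine ⟨S, i1, i2, φ, i3, i4, i5, hφ, (fun s => (φ x)⁻¹ * s) ⁻¹' O',
        hO'.preimage (continuous_const_mul _), by simpa using h1O', fun y hy => ?_⟩
      have : φ ((x : G)⁻¹ * y) ∈ O := hO'O (by simpa using hy)
      simpa using hOV this
    choose S i1 i2 φ i3 i4 i5 hφ O hO hxO hOV using hpt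
    obtain ⟨t, ht, hcov⟩ := (HereditarilyLindelofSpace.isLindelof V).elim_countable_subcover
      (fun x => φ x ⁻¹' O x) (fun x => (hO x).preimage (hφ x))
      (fun x hx => mem_iUnion.2 ⟨⟨x, hx⟩, hxO _⟩)
    have := ht.to_subtype
    refine ⟨∀ x : t, S x, inferInstance, inferInstance, MonoidHom.pi fun x : t => φ x,
      inferInstance, inferInstance, inferInstance, continuous_pi fun x => hφ x,
      ⋃ x : t, (fun s => s x) ⁻¹' O x, isOpen_iUnion fun x => (hO x).preimage (continuous_apply x),
      ?_⟩
    ext y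
    simp only [preimage_iUnion, mem_iUnion]
    constructor
    · intro hy
      obtain ⟨x, hx, hxy⟩ := mem_iUnion₂.1 (hcov hy)
      exact ⟨⟨x, hx⟩, hxy⟩
    · rintro ⟨x, hx⟩
      exact hOV x hx
  -- One homomorphism `ψ` serves the preimages under `f` of all members of a countable base of `ℝ`.
  obtain ⟨b, hbc, -, hb⟩ := TopologicalSpace.exists_countable_basis ℝ
  have := hbc.to_subtype
  choose S i1 i2 φ i3 i4 i5 hφ O hO hVO using
    fun V : b => hopen (f ⁻¹' V) ((hb.isOpen V.2).preimage hf)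
  let ψ : G →* ∀ V : b, S V := MonoidHom.pi φ
  have hψ : Continuous ψ := continuous_pi hφ
  have hmem : ∀ (V : b) x, f x ∈ (V : Set ℝ) ↔ ψ x V ∈ O V := fun V x => Set.ext_iff.1 (hVO V) x
  have hinj : ∀ x y, ψ x = ψ y → f x = f y := by
    intro x y hxy
    by_contra hne
    obtain ⟨V, hV, hxV, hVs⟩ := hb.exists_subset_of_mem_open (a := f x) (u := {f y}ᶜ) hne
      isOpen_compl_singleton
    have hy := (hmem ⟨V, hV⟩ y).2 (hxy ▸ (hmem ⟨V, hV⟩ x).1 hxV)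
    exact hVs hy rfl
  let h : ψ.range → ℝ := fun s => f s.2.choose
  have hh : ∀ s x, ψ x = s.1 → h s = f x := fun s x hx => hinj _ _ (s.2.choose_spec.trans hx.symm)
  refine ⟨ψ.range, inferInstance, inferInstance, ψ.rangeRestrict, h, inferInstance, inferInstance,
    TopologicalSpace.Subtype.secondCountableTopology (ψ.range : Set (∀ V : b, S V)),
    hψ.subtype_mk _, ?_, ?_⟩
  · refine hb.continuous_iff.2 fun V hV => ?_
    have : h ⁻¹' V = (fun s : ψ.range => s.1 ⟨V, hV⟩) ⁻¹' O ⟨V, hV⟩ := by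
      ext s
      obtain ⟨x, hx⟩ := s.2
      rw [mem_preimage, hh s x hx, mem_preimage, ← hx]
      exact hmem ⟨V, hV⟩ x
    rw [this]
    exact (hO _).preimage ((continuous_apply _).comp continuous_subtype_val)
  · funext x
    exact (hh _ x rfl).symm

end kernels

/-! ### Lattices of cosmic quotients -/

/-- A countable network of the quotient space `G ⧸ L`, expressed by subsets of `G`. -/
def HasNetworkMod {G : Type*} [Group G] [TopologicalSpace G] (L : Subgroup G) : Prop :=
  ∃ N : Set (Set G), N.Countable ∧
    ∀ (x : G) (U : Set G), IsOpen U → x ∈ U → ∃ A ∈ N, x ∈ A ∧ A ⊆ U * (L : Set G)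

/-- A family of closed normal subgroups whose quotients have countable networks, which is cofinal
among the `G_δ`-sets containing the identity and closed under limits of decreasing sequences:
the quotient by the intersection `L` of such a sequence carries the topology generated by the
quotients by its members (`exists_subset_mul`). -/
structure IsCosmicLattice {G : Type*} [Group G] [TopologicalSpace G] (𝓛 : Set (Subgroup G)) :
    Prop where
  normal : ∀ L ∈ 𝓛, L.Normal
  isClosed : ∀ L ∈ 𝓛, IsClosed (L : Set G)
  hasNetworkMod : ∀ L ∈ 𝓛, HasNetworkMod L
  exists_subset : ∀ P : Set G, IsGδ P → 1 ∈ P → ∃ L ∈ 𝓛, (L : Set G) ⊆ P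
  iInf_mem : ∀ L : ℕ → Subgroup G, Antitone L → (∀ n, L n ∈ 𝓛) → ⨅ n, L n ∈ 𝓛
  exists_subset_mul : ∀ L : ℕ → Subgroup G, Antitone L → (∀ n, L n ∈ 𝓛) → ∀ U ∈ 𝓝 (1 : G),
    ∃ n, (L n : Set G) ⊆ U * ((⨅ n, L n : Subgroup G) : Set G)

section lattice

variable {G : Type u} [Group G] [TopologicalSpace G]

theorem HasNetworkMod.hasCountableNetwork {L : Subgroup G} (hL : HasNetworkMod L) :
    HasCountableNetwork (G ⧸ L) := by
  obtain ⟨N, hN, h⟩ := hL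
  refine ⟨image ((↑) : G → G ⧸ L) '' N, hN.image _, fun q U hU hq => ?_⟩
  obtain ⟨x, rfl⟩ := QuotientGroup.mk_surjective q
  obtain ⟨A, hA, hxA, hAU⟩ := h x _ (hU.preimage QuotientGroup.continuous_mk) hq
  refine ⟨_, mem_image_of_mem _ hA, mem_image_of_mem _ hxA, ?_⟩
  rintro _ ⟨a, ha, rfl⟩
  obtain ⟨u, hu, l, hl, rfl⟩ := hAU ha
  have : ((u * l : G) : G ⧸ L) = u := QuotientGroup.mk_mul_of_mem u hl
  simpa [this] using hu

theorem HasNetworkMod.exists_countable_dense {L : Subgroup G} (hL : HasNetworkMod L) (P : Set G) :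
    ∃ D ⊆ P, D.Countable ∧ ∀ x ∈ P, ∀ U, IsOpen U → x ∈ U → ∃ d ∈ D, d ∈ U * (L : Set G) := by
  obtain ⟨N, hN, h⟩ := hL
  have := hN.to_subtype
  choose c hc using fun A : {A : N // (P ∩ A).Nonempty} => A.2
  refine ⟨range c, ?_, countable_range c, fun x hx U hU hxU => ?_⟩
  · rintro _ ⟨A, rfl⟩
    exact (hc A).1
  · obtain ⟨A, hA, hxA, hAU⟩ := h x U hU hxU
    exact ⟨_, mem_range_self ⟨⟨A, hA⟩, x, hx, hxA⟩, hAU (hc ⟨⟨A, hA⟩, x, hx, hxA⟩).2⟩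

theorem IsOmegaCellular.isNarrow [IsTopologicalGroup G] (hG : IsOmegaCellular G) : IsNarrow G := by
  intro U hU
  have h1 : Tendsto (fun p : G × G => p.1 * p.2⁻¹) (𝓝 1 ×ˢ 𝓝 1) (𝓝 1) := by
    rw [← nhds_prod_eq]
    exact Continuous.tendsto' (by fun_prop) _ _ (by simp)
  have hb := nhds_basis_opens (1 : G)
  obtain ⟨⟨V, W⟩, ⟨⟨hV1, hV⟩, hW1, hW⟩, hVW⟩ := ((hb.prod hb).tendsto_left_iff).1 h1 U hU
  obtain ⟨E, hEF, hE, hd⟩ := hG (range fun x : G => x • V) <| by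
    rintro _ ⟨x, rfl⟩
    exact (hV.smul x).isGδ
  choose! c hc using fun A (hA : A ∈ E) => hEF hA
  refine ⟨c '' E, hE.image c, eq_univ_of_forall fun x => ?_⟩
  have hx := hd (mem_sUnion.2 ⟨x • V, mem_range_self x, ⟨1, hV1, mul_one x⟩⟩)
  obtain ⟨_, ⟨w, hw, rfl⟩, A, hA, hxA⟩ := mem_closure_iff.1 hx (x • W) (hW.smul x)
    ⟨1, hW1, mul_one x⟩
  rw [← hc A hA] at hxA
  obtain ⟨v, hv, hvw⟩ := hxA
  refine ⟨_, mem_image_of_mem c hA, v * w⁻¹, hVW (show (v, w) ∈ V ×ˢ W from ⟨hv, hw⟩), ?_⟩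
  have : c A * v = x * w := hvw
  simp [← mul_assoc, this]

variable [IsTopologicalGroup G] {𝓛 : Set (Subgroup G)}

namespace IsCosmicLattice

theorem isGδ (h𝓛 : IsCosmicLattice 𝓛) {L : Subgroup G} (hL : L ∈ 𝓛) : IsGδ (L : Set G) := by
  have := h𝓛.normal L hL
  have : IsClosed (L : Set G) := h𝓛.isClosed L hL
  have := (h𝓛.hasNetworkMod L hL).hasCountableNetwork.perfectlyNormalSpace
  have h := ((isClosed_singleton (x := (1 : G ⧸ L))).isGδ).preimage
    (f := ((↑) : G → G ⧸ L)) QuotientGroup.continuous_mk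
  convert h using 1
  ext x
  simp

/-- The quotient maps to the members of a lattice determine the closure of the union of any family
of `G_δ`-sets: along a suitable decreasing sequence of members, countably many members of the
family, dense modulo each term of the sequence, contain full cosets of its intersection. -/
theorem exists_mul_subset_closure (h𝓛 : IsCosmicLattice 𝓛) (F : Set (Set G))
    (hF : ∀ A ∈ F, IsGδ A) :
    ∃ E ⊆ F, E.Countable ∧ ∃ L ∈ 𝓛, ⋃₀ F * (L : Set G) ⊆ closure (⋃₀ E) := by
  choose! A hAF hxA using fun x (hx : x ∈ ⋃₀ F) => hx
  have hD : ∀ L : 𝓛, ∃ D ⊆ ⋃₀ F, D.Countable ∧ ∀ x ∈ ⋃₀ F, ∀ U, IsOpen U → x ∈ U →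
      ∃ d ∈ D, d ∈ U * ((L : Subgroup G) : Set G) :=
    fun L => (h𝓛.hasNetworkMod L L.2).exists_countable_dense _
  choose D hDF hDc hDd using hD
  have hnext : ∀ L : 𝓛, ∃ L' : 𝓛, (L' : Subgroup G) ≤ L ∧
      ∀ d ∈ D L, ∀ l ∈ (L' : Subgroup G), d * l ∈ A d := by
    intro L
    have hG : IsGδ (((L : Subgroup G) : Set G) ∩ ⋂ d ∈ D L, (fun l => d * l) ⁻¹' A d) := by
      refine (h𝓛.isGδ L.2).inter (IsGδ.biInter (hDc L) fun d hd => ?_)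
      exact (hF _ (hAF d (hDF L hd))).preimage (continuous_const_mul d)
    obtain ⟨L', hL', hs⟩ := h𝓛.exists_subset _ hG
      ⟨one_mem _, mem_iInter₂.2 fun d hd => by simpa using hxA d (hDF L hd)⟩
    exact ⟨⟨L', hL'⟩, fun l hl => (hs hl).1, fun d hd l hl => mem_iInter₂.1 (hs hl).2 d hd⟩
  choose next hle hmem using hnext
  obtain ⟨L₀, hL₀, -⟩ := h𝓛.exists_subset univ IsGδ.univ (mem_univ 1)
  let L : ℕ → 𝓛 := fun n => next^[n] ⟨L₀, hL₀⟩
  have hsucc : ∀ n, L (n + 1) = next (L n) := fun n => Function.iterate_succ_apply' _ _ _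
  have hanti : Antitone fun n => (L n : Subgroup G) :=
    antitone_nat_of_succ_le fun n => by rw [hsucc]; exact hle _
  have hinf := h𝓛.iInf_mem _ hanti fun n => (L n).2
  have hlim := h𝓛.exists_subset_mul _ hanti fun n => (L n).2
  set M : Subgroup G := ⨅ n, (L n : Subgroup G) with hM
  have hMn := h𝓛.normal M hinf
  refine ⟨⋃ n, A '' D (L n), ?_, countable_iUnion fun n => (hDc _).image A, M, hinf, ?_⟩
  · refine iUnion_subset fun n => ?_
    rintro _ ⟨d, hd, rfl⟩
    exact hAF d (hDF _ hd)
  rintro _ ⟨x, hx, m, hm, rfl⟩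
  refine mem_closure_iff.2 fun U hU hxU => ?_
  have h1 : Tendsto (fun p : G × G => x * (p.1 * p.2) * m) (𝓝 1 ×ˢ 𝓝 1) (𝓝 (x * m)) := by
    rw [← nhds_prod_eq]
    exact Continuous.tendsto' (by fun_prop) _ _ (by simp)
  have hb := nhds_basis_opens (1 : G)
  obtain ⟨⟨V, W⟩, ⟨⟨hV1, hV⟩, hW1, hW⟩, hVW⟩ :=
    ((hb.prod hb).tendsto_left_iff).1 h1 U (hU.mem_nhds hxU)
  obtain ⟨n, hn⟩ := hlim W (hW.mem_nhds hW1)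
  obtain ⟨d, hd, y, hy, l, hl, hdyl⟩ := hDd (L n) x hx (x • V) (hV.smul x) ⟨1, hV1, by simp⟩
  obtain ⟨v, hv, rfl⟩ := hy
  obtain ⟨w, hw, k, hk, rfl⟩ := hn hl
  have hU' : x * (v * w) * m ∈ U := hVW (show (v, w) ∈ V ×ˢ W from ⟨hv, hw⟩)
  -- `d = x v w k`, so `x v w m = d k⁻¹ m`, and `k⁻¹ m` lies in `L (n + 1)`.
  refine ⟨_, hU', A d, mem_iUnion.2 ⟨n, mem_image_of_mem A hd⟩, ?_⟩
  have hkm : k⁻¹ * m ∈ (next (L n) : Subgroup G) := by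
    rw [← hsucc]
    exact Subgroup.mem_iInf.1 (mul_mem (inv_mem hk) hm) (n + 1)
  convert hmem (L n) d hd _ hkm using 1
  rw [← hdyl]
  simp [mul_assoc]

theorem isOmegaCellular (h𝓛 : IsCosmicLattice 𝓛) : IsOmegaCellular G := by
  intro F hF
  obtain ⟨E, hEF, hE, L, -, hL⟩ := h𝓛.exists_mul_subset_closure F hF
  exact ⟨E, hEF, hE, fun x hx => hL ⟨x, hx, 1, one_mem L, mul_one x⟩⟩

/-- The closure of a `G_{δ,Σ}`-set is a union of cosets of a member of the lattice. -/
theorem exists_closure_mul_subset (h𝓛 : IsCosmicLattice 𝓛) {P : Set G} (hP : IsGdeltaSigma P) :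
    ∃ L ∈ 𝓛, ∀ x ∈ closure P, ∀ l ∈ L, x * l ∈ closure P := by
  obtain ⟨F, hF, rfl⟩ := hP
  obtain ⟨E, hEF, hE, L, hL, hsub⟩ := h𝓛.exists_mul_subset_closure F hF
  refine ⟨L, hL, fun x hx l hl => ?_⟩
  have hmaps : MapsTo (fun y => y * l) (⋃₀ F) (closure (⋃₀ F)) := fun y hy =>
    closure_mono (sUnion_subset_sUnion hEF) (hsub ⟨y, hy, l, hl, rfl⟩)
  exact closure_minimal hmaps.subset_preimage
    (isClosed_closure.preimage (continuous_mul_const l)) hx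

theorem exists_le (h𝓛 : IsCosmicLattice 𝓛) {ι : Type*} [Countable ι] {L : ι → Subgroup G}
    (hL : ∀ i, L i ∈ 𝓛) : ∃ M ∈ 𝓛, ∀ i, M ≤ L i := by
  obtain ⟨M, hM, hs⟩ := h𝓛.exists_subset (⋂ i, (L i : Set G))
    (IsGδ.iInter fun i => h𝓛.isGδ (hL i)) (mem_iInter.2 fun i => one_mem (L i))
  exact ⟨M, hM, fun i x hx => mem_iInter.1 (hs hx) i⟩

theorem isZeroSet_closure (h𝓛 : IsCosmicLattice 𝓛) {P : Set G} (hP : IsGdeltaSigma P) :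
    IsZeroSet (closure P) := by
  obtain ⟨L, hL, hsat⟩ := h𝓛.exists_closure_mul_subset hP
  have := h𝓛.normal L hL
  have : IsClosed (L : Set G) := h𝓛.isClosed L hL
  have hpre : ((↑) : G → G ⧸ L) ⁻¹' (((↑) : G → G ⧸ L) '' closure P) = closure P := by
    refine Subset.antisymm ?_ (subset_preimage_image _ _)
    rintro x ⟨y, hy, hyx⟩
    simpa using hsat y hy _ (QuotientGroup.eq.1 hyx)
  have hcl : IsClosed (((↑) : G → G ⧸ L) '' closure P) := by
    rw [← (QuotientGroup.isQuotientMap_mk L).isClosed_preimage, hpre]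
    exact isClosed_closure
  obtain ⟨f, hf, hfs⟩ := hcl.isZeroSet (h𝓛.hasNetworkMod L hL).hasCountableNetwork
  exact ⟨f ∘ (↑), hf.comp QuotientGroup.continuous_mk, by rw [preimage_comp, ← hfs, hpre]⟩

theorem isNarrow (h𝓛 : IsCosmicLattice 𝓛) : IsNarrow G :=
  h𝓛.isOmegaCellular.isNarrow

/-- The sublevel sets of a continuous function have closures saturated with respect to some member
of the lattice, so the function factors through the quotient by that member. -/
theorem exists_factor (h𝓛 : IsCosmicLattice 𝓛) {f : G → ℝ} (hf : Continuous f) :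
    ∃ L ∈ 𝓛, ∀ x, ∀ l ∈ L, f (x * l) = f x := by
  have hP : ∀ q : ℚ, IsGdeltaSigma (f ⁻¹' Iio (q : ℝ)) := fun q =>
    ⟨{f ⁻¹' Iio (q : ℝ)}, by simpa using (isOpen_Iio.preimage hf).isGδ, by simp⟩
  choose L hL hsat using fun q => h𝓛.exists_closure_mul_subset (hP q)
  obtain ⟨M, hM, hle⟩ := h𝓛.exists_le hL
  have key : ∀ x, ∀ l ∈ M, f (x * l) ≤ f x := by
    intro x l hl
    refine le_of_forall_gt_imp_ge_of_dense fun b hb => ?_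
    obtain ⟨q, hxq, hqb⟩ := exists_rat_btwn hb
    have h1 := hsat q x (subset_closure hxq) l (hle q hl)
    have h2 : closure (f ⁻¹' Iio (q : ℝ)) ⊆ f ⁻¹' Iic (q : ℝ) :=
      closure_minimal (preimage_mono Iio_subset_Iic_self) (isClosed_Iic.preimage hf)
    exact (h2 h1).trans hqb.le
  refine ⟨M, hM, fun x l hl => le_antisymm (key x l hl) ?_⟩
  simpa using key (x * l) l⁻¹ (inv_mem hl)

theorem isRFactorizable (h𝓛 : IsCosmicLattice 𝓛) : IsRFactorizable G := by
  intro f hf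
  obtain ⟨L, hL, hfL⟩ := h𝓛.exists_factor hf
  have := h𝓛.normal L hL
  let g : G ⧸ L → ℝ := Quotient.lift f fun a b hab => by
    have h := hfL a _ (QuotientGroup.leftRel_apply.1 hab)
    simpa using h.symm
  have hg : Continuous g := hf.quotient_lift _
  have hn : IsNarrow (G ⧸ L) := h𝓛.isNarrow.of_surjective (QuotientGroup.mk' L)
    QuotientGroup.continuous_mk (QuotientGroup.mk'_surjective L)
  obtain ⟨S, i1, i2, π, h, i3, i4, i5, hπ, hh, hgh⟩ :=
    hn.isRFactorizable (h𝓛.hasNetworkMod L hL).hasCountableNetwork g hg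
  refine ⟨S, i1, i2, π.comp (QuotientGroup.mk' L), h, i3, i4, i5,
    hπ.comp QuotientGroup.continuous_mk, hh, funext fun x => ?_⟩
  exact congrFun hgh (x : G ⧸ L)

theorem isEfimov (h𝓛 : IsCosmicLattice 𝓛) : IsEfimov G := by
  intro P hP
  obtain ⟨f, hf, h⟩ := h𝓛.isZeroSet_closure hP
  rw [h]
  exact (IsGδ.singleton (0 : ℝ)).preimage hf

end IsCosmicLattice

end lattice

/-! ### Products of groups with countable networks -/

section pi

variable {I : Type*} {H : I → Type*} [∀ i, Group (H i)] [∀ i, TopologicalSpace (H i)]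

theorem hasNetworkMod_pi (hH : ∀ i, HasCountableNetwork (H i)) {J : Set I} (hJ : J.Countable)
    (L : Subgroup (∀ i, H i)) (hL : ∀ x, x ∈ L ↔ ∀ i ∈ J, x i = 1) : HasNetworkMod L := by
  choose N hN hNet using hH
  have := hJ.to_subtype
  have := fun i => (hN i).to_subtype
  -- The network consists of the boxes given by finitely many network elements with index in `J`.
  refine ⟨range fun T : Finset (Σ i : J, N i) => {x | ∀ t ∈ T, x t.1 ∈ (t.2 : Set (H t.1))},
    countable_range _, fun x U hU hx => ?_⟩
  obtain ⟨F, V, hV, hVU⟩ := isOpen_pi_iff.1 hU x hx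
  choose! A hAN hxA hAV using fun i (hi : i ∈ F) => hNet i (x i) (V i) (hV i hi).1 (hV i hi).2
  classical
  let T : Finset (Σ i : J, N i) :=
    Finset.univ.image fun i : {i : F // (i : I) ∈ J} => ⟨⟨i.1, i.2⟩, ⟨A i.1, hAN _ i.1.2⟩⟩
  refine ⟨_, mem_range_self T, fun t ht => ?_, fun y hy => ?_⟩
  · obtain ⟨i, -, rfl⟩ := Finset.mem_image.1 ht
    exact hxA _ i.1.2
  · refine ⟨fun i => if i ∈ J then y i else x i, hVU fun i hi => ?_,
      (fun i => if i ∈ J then y i else x i)⁻¹ * y, (hL _).2 fun i hi => ?_, mul_inv_cancel_left _ _⟩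
    · by_cases hiJ : i ∈ J
      · have := hy _ (Finset.mem_image_of_mem _ (Finset.mem_univ ⟨⟨i, hi⟩, hiJ⟩))
        simpa [hiJ] using hAV i hi this
      · simpa [hiJ] using (hV i hi).2
    · simp [hi]

/-- The subgroups of a product given by the vanishing of countably many coordinates form a
lattice. -/
theorem isCosmicLattice_pi [∀ i, T1Space (H i)] (hH : ∀ i, HasCountableNetwork (H i)) :
    IsCosmicLattice {L : Subgroup (∀ i, H i) | ∃ J : Set I, J.Countable ∧
      ∀ x, x ∈ L ↔ ∀ i ∈ J, x i = 1} where
  normal := by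
    rintro L ⟨J, -, hL⟩
    refine ⟨fun x hx g => (hL _).2 fun i hi => ?_⟩
    simp [(hL x).1 hx i hi]
  isClosed := by
    rintro L ⟨J, -, hL⟩
    have : (L : Set (∀ i, H i)) = ⋂ i ∈ J, (fun x => x i) ⁻¹' {1} := by
      ext x
      simpa using hL x
    rw [this]
    exact isClosed_biInter fun i _ => isClosed_singleton.preimage (continuous_apply i)
  hasNetworkMod := by
    rintro L ⟨J, hJ, hL⟩
    exact hasNetworkMod_pi hH hJ L hL
  exists_subset := by
    intro P hP h1
    obtain ⟨U, hU, rfl⟩ := isGδ_iff_eq_iInter_nat.1 hP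
    choose F V hV hVU using fun n => isOpen_pi_iff.1 (hU n) 1 (mem_iInter.1 h1 n)
    let J : Set I := ⋃ n, (F n : Set I)
    let L : Subgroup (∀ i, H i) :=
      { carrier := {x | ∀ i ∈ J, x i = 1}
        one_mem' := fun i _ => rfl
        mul_mem' := fun {x y} hx hy i hi => by simp [hx i hi, hy i hi]
        inv_mem' := fun {x} hx i hi => by simp [hx i hi] }
    refine ⟨L, ⟨J, countable_iUnion fun n => (F n).countable_toSet, fun x => Iff.rfl⟩, ?_⟩
    intro x hx
    refine mem_iInter.2 fun n => hVU n fun i hi => ?_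
    have : x i = 1 := hx i (mem_iUnion.2 ⟨n, hi⟩)
    rw [this]
    exact (hV n i hi).2
  iInf_mem := by
    intro L _ hL
    choose J hJ hLJ using hL
    refine ⟨⋃ n, J n, countable_iUnion hJ, fun x => ?_⟩
    simp only [Subgroup.mem_iInf, hLJ, mem_iUnion]
    exact ⟨fun h i ⟨n, hi⟩ => h n i hi, fun h n i hi => h i ⟨n, hi⟩⟩
  exists_subset_mul := by
    intro L hanti hL U hU
    choose J hJ hLJ using hL
    obtain ⟨U', hU'U, hU', h1U'⟩ := mem_nhds_iff.1 hU
    obtain ⟨F, V, hV, hVU⟩ := isOpen_pi_iff.1 hU' 1 h1U'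
    -- Far along the sequence, the coordinates in `F` that vanish on the intersection all vanish.
    have hn : ∃ n, ∀ i ∈ F, i ∈ ⋃ n, J n → ∀ x ∈ L n, x i = 1 := by
      choose! m hm using fun i (hi : i ∈ ⋃ n, J n) => mem_iUnion.1 hi
      refine ⟨F.sup m, fun i hi hiJ x hx => ?_⟩
      exact (hLJ _ x).1 (hanti (Finset.le_sup hi) hx) i (hm i hiJ)
    obtain ⟨n, hn⟩ := hn
    refine ⟨n, fun x hx => ?_⟩
    classical
    refine ⟨fun i => if i ∈ ⋃ n, J n then x i else 1, hU'U (hVU fun i hi => ?_),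
      (fun i => if i ∈ ⋃ n, J n then x i else 1)⁻¹ * x, ?_, mul_inv_cancel_left _ _⟩
    · have h1V : (1 : H i) ∈ V i := (hV i hi).2
      by_cases hiJ : i ∈ ⋃ n, J n
      · simpa only [if_pos hiJ, hn i hi hiJ x hx] using h1V
      · simpa only [if_neg hiJ] using h1V
    · refine Subgroup.mem_iInf.2 fun k => (hLJ k _).2 fun i hi => ?_
      have : i ∈ ⋃ n, J n := mem_iUnion.2 ⟨k, hi⟩
      simp only [Pi.mul_apply, Pi.inv_apply, if_pos this, inv_mul_cancel]

end pi

/-! ### Invariance under homeomorphisms of the underlying spaces -/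

section homeomorph

theorem IsOmegaCellular.of_homeomorph {X Y : Type*} [TopologicalSpace X] [TopologicalSpace Y]
    (hX : IsOmegaCellular X) (e : Y ≃ₜ X) : IsOmegaCellular Y := by
  intro F hF
  obtain ⟨E, hEF, hE, hd⟩ := hX (preimage e.symm '' F) <| by
    rintro _ ⟨A, hA, rfl⟩
    exact (hF A hA).preimage e.symm.continuous
  refine ⟨preimage e '' E, ?_, hE.image _, fun y hy => ?_⟩
  · rintro _ ⟨B, hB, rfl⟩
    obtain ⟨A, hA, rfl⟩ := hEF hB
    rwa [← preimage_comp, e.symm_comp_self]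
  · obtain ⟨A, hA, hyA⟩ := hy
    have h1 : e y ∈ closure (⋃₀ E) := hd ⟨_, mem_image_of_mem _ hA, by simpa using hyA⟩
    have h2 : y ∈ e ⁻¹' closure (⋃₀ E) := h1
    rw [e.preimage_closure, sUnion_eq_biUnion, preimage_iUnion₂] at h2
    rwa [sUnion_image]

variable {Q : Type u} [Group Q] [TopologicalSpace Q] [IsTopologicalGroup Q]
  {X : Type*} [Group X] [TopologicalSpace X] [IsTopologicalGroup X] {𝓛 : Set (Subgroup X)}

/-- By `ω`-cellularity, countably many translates `x N_x` have dense union, where `N_x` is a kernel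
such that `e` maps `x N_x` into a coset of `L`; then the intersection of the corresponding `N_x`
works at all points, as `L` is closed. -/
theorem IsCosmicLattice.exists_kernel (h𝓛 : IsCosmicLattice 𝓛) (e : Q ≃ₜ X) {L : Subgroup X}
    (hL : L ∈ 𝓛) : ∃ N : Subgroup Q, IsSecondCountableKernel N ∧
      ∀ x, ∀ n ∈ N, (e x)⁻¹ * e (x * n) ∈ L := by
  have hQ := h𝓛.isOmegaCellular.of_homeomorph e
  have hpt : ∀ x, ∃ N : Subgroup Q, IsSecondCountableKernel N ∧
      ∀ n ∈ N, (e x)⁻¹ * e (x * n) ∈ L := fun x =>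
    hQ.isNarrow.exists_isSecondCountableKernel_subset
      (P := (fun n => (e x)⁻¹ * e (x * n)) ⁻¹' (L : Set X))
      ((h𝓛.isGδ hL).preimage (by fun_prop)) (by simp)
  choose N hN hNL using hpt
  obtain ⟨E, hEF, hE, hd⟩ := hQ (range fun x : Q => x • (N x : Set Q)) <| by
    rintro _ ⟨x, rfl⟩
    have := (hN x).isGδ.preimage (f := fun y => x⁻¹ * y) (continuous_const_mul _)
    rwa [show (fun y => x⁻¹ * y) ⁻¹' (N x : Set Q) = x • (N x : Set Q) from
      preimage_smul_inv x _] at this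
  choose! c hc using fun A (hA : A ∈ E) => hEF hA
  have hmem : ∀ x : Q, x ∈ closure (⋃₀ E) := fun x =>
    hd (mem_sUnion.2 ⟨_, mem_range_self x, 1, one_mem (N x), mul_one x⟩)
  have hne : E.Nonempty := by
    obtain ⟨_, -, A, hA, -⟩ := mem_closure_iff.1 (hmem 1) univ isOpen_univ (mem_univ 1)
    exact ⟨A, hA⟩
  obtain ⟨a, rfl⟩ := hE.exists_eq_range hne
  refine ⟨⨅ k, N (c (a k)), .iInf fun k => hN _, fun x n hn => ?_⟩
  have hcl : IsClosed {y | (e y)⁻¹ * e (y * n) ∈ L} :=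
    (h𝓛.isClosed L hL).preimage (f := fun y => (e y)⁻¹ * e (y * n)) (by fun_prop)
  refine closure_minimal ?_ hcl (hmem x)
  rintro y ⟨_, ⟨k, rfl⟩, hy⟩
  rw [← hc (a k) (mem_range_self k)] at hy
  obtain ⟨m, hm, rfl⟩ := hy
  have h1 := hNL _ m hm
  have h2 := hNL _ (m * n) (mul_mem hm (Subgroup.mem_iInf.1 hn k))
  have h3 := mul_mem (inv_mem h1) h2
  simpa [mul_assoc] using h3

omit [IsTopologicalGroup Q] in
/-- The closures of the preimages of basic open sets under a homomorphism to a second countable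
group are saturated with respect to a member of the lattice, and they separate the cosets of the
kernel. -/
theorem IsCosmicLattice.exists_le_of_kernel (h𝓛 : IsCosmicLattice 𝓛) (e : Q ≃ₜ X)
    {N : Subgroup Q} (hN : IsSecondCountableKernel N) {L₀ : Subgroup X} (hL₀ : L₀ ∈ 𝓛) :
    ∃ L ∈ 𝓛, L ≤ L₀ ∧ ∀ x y, (e x)⁻¹ * e y ∈ L → x⁻¹ * y ∈ N := by
  obtain ⟨S, _, _, φ, _, _, _, hφ, rfl⟩ := hN
  obtain ⟨b, hbc, -, hb⟩ := TopologicalSpace.exists_countable_basis S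
  have := hbc.to_subtype
  have hP : ∀ V : b, IsGdeltaSigma ((fun z => φ (e.symm z)) ⁻¹' (V : Set S)) := fun V =>
    ⟨{(fun z => φ (e.symm z)) ⁻¹' (V : Set S)},
      by simpa using ((hb.isOpen V.2).preimage (by fun_prop)).isGδ, by simp⟩
  choose L hL hsat using fun V => h𝓛.exists_closure_mul_subset (hP V)
  obtain ⟨M, hM, hle⟩ := h𝓛.exists_le (L := fun V : Option b => V.elim L₀ L) <| by
    rintro (_ | V)
    exacts [hL₀, hL V]
  refine ⟨M, hM, hle none, fun x y hxy => ?_⟩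
  by_contra hne
  have hne' : φ x ∈ ({φ y}ᶜ : Set S) := by
    intro h
    rw [mem_singleton_iff] at h
    exact hne (by simp [MonoidHom.mem_ker, h])
  obtain ⟨C, hC, hCc, hCs⟩ :=
    exists_mem_nhds_isClosed_subset (isOpen_compl_singleton.mem_nhds hne')
  obtain ⟨V, hV, hxV, hVC⟩ := hb.mem_nhds_iff.1 hC
  have h1 := hsat ⟨V, hV⟩ (e x) (subset_closure (by simpa using hxV)) _ (hle (some ⟨V, hV⟩) hxy)
  have h2 : closure ((fun z => φ (e.symm z)) ⁻¹' V) ⊆ (fun z => φ (e.symm z)) ⁻¹' C :=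
    closure_minimal (preimage_mono hVC) (hCc.preimage (by fun_prop))
  have h3 := h2 h1
  simp only [mul_inv_cancel_left, mem_preimage, e.symm_apply_apply] at h3
  exact hCs h3 rfl

/-- A homeomorphism to a group with a lattice transports those members whose cosets
correspond to the cosets of a normal subgroup. There are enough of them, since kernels of
homomorphisms to second countable groups and members of the lattice can be interlaced. -/
theorem IsCosmicLattice.of_homeomorph (h𝓛 : IsCosmicLattice 𝓛) (e : Q ≃ₜ X) :
    IsCosmicLattice {N : Subgroup Q | N.Normal ∧
      ∃ L ∈ 𝓛, ∀ x y, x⁻¹ * y ∈ N ↔ (e x)⁻¹ * e y ∈ L} where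
  normal := fun N hN => hN.1
  isClosed := by
    rintro N ⟨-, L, hL, h⟩
    have : (N : Set Q) = (fun x => (e 1)⁻¹ * e x) ⁻¹' L := by
      ext x
      simpa using h 1 x
    rw [this]
    exact (h𝓛.isClosed L hL).preimage (by fun_prop)
  hasNetworkMod := by
    rintro N ⟨-, L, hL, h⟩
    obtain ⟨A, hA, hnet⟩ := h𝓛.hasNetworkMod L hL
    refine ⟨preimage e '' A, hA.image _, fun x U hU hx => ?_⟩
    obtain ⟨B, hB, hxB, hBU⟩ := hnet (e x) (e '' U) (e.isOpenMap U hU) (mem_image_of_mem e hx)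
    refine ⟨_, mem_image_of_mem _ hB, hxB, fun y hy => ?_⟩
    obtain ⟨_, ⟨u, hu, rfl⟩, l, hl, hul⟩ := hBU hy
    refine ⟨u, hu, u⁻¹ * y, (h u y).2 ?_, mul_inv_cancel_left u y⟩
    rw [← hul]
    simpa using hl
  exists_subset := by
    intro P hP h1
    have hQ := (h𝓛.isOmegaCellular.of_homeomorph e).isNarrow
    obtain ⟨N₀, hN₀, hN₀P⟩ := hQ.exists_isSecondCountableKernel_subset hP h1
    obtain ⟨L', hL', -⟩ := h𝓛.exists_subset univ IsGδ.univ (mem_univ 1)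
    obtain ⟨L₀, hL₀, -, hLN₀⟩ := h𝓛.exists_le_of_kernel e hN₀ hL'
    choose N hN hNL using fun L : 𝓛 => h𝓛.exists_kernel e L.2
    have hnext : ∀ L : 𝓛, ∃ M : 𝓛, (M : Subgroup X) ≤ L ∧
        ∀ x y, (e x)⁻¹ * e y ∈ (M : Subgroup X) → x⁻¹ * y ∈ N L := by
      intro L
      obtain ⟨M, hM, h⟩ := h𝓛.exists_le_of_kernel e (hN L) L.2
      exact ⟨⟨M, hM⟩, h⟩
    choose next hle hmem using hnext
    let L : ℕ → 𝓛 := fun n => next^[n] ⟨L₀, hL₀⟩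
    have hsucc : ∀ n, L (n + 1) = next (L n) := fun n => Function.iterate_succ_apply' _ _ _
    have hanti : Antitone fun n => (L n : Subgroup X) :=
      antitone_nat_of_succ_le fun n => by rw [hsucc]; exact hle _
    have hiff : ∀ x y, x⁻¹ * y ∈ ⨅ n, N (L n) ↔
        (e x)⁻¹ * e y ∈ ⨅ n, (L n : Subgroup X) := by
      intro x y
      simp only [Subgroup.mem_iInf]
      refine ⟨fun h n => by simpa using hNL (L n) x _ (h n), fun h n => hmem (L n) x y ?_⟩
      rw [← hsucc]
      exact h (n + 1)
    have hK : IsSecondCountableKernel (⨅ n, N (L n)) := .iInf fun n => hN _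
    refine ⟨⨅ n, N (L n), ⟨hK.normal, _, h𝓛.iInf_mem _ hanti fun n => (L n).2, hiff⟩, ?_⟩
    intro x hx
    have h0 := Subgroup.mem_iInf.1 ((hiff 1 x).1 (by simpa using hx)) 0
    simpa using hN₀P (hLN₀ 1 x h0)
  iInf_mem := by
    intro N hanti hN
    choose hn L hL hNL using hN
    refine ⟨Subgroup.normal_iInf_normal hn, ⨅ n, L n, h𝓛.iInf_mem L ?_ hL, fun x y => ?_⟩
    · intro m n hmn l hl
      have h1 := (hNL n 1 (e.symm (e 1 * l))).2 (by simpa using hl)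
      simpa using (hNL m 1 _).1 (hanti hmn h1)
    · simp only [Subgroup.mem_iInf, hNL]
  exists_subset_mul := by
    intro N hanti hN U hU
    choose hn L hL hNL using hN
    have hantiL : Antitone L := by
      intro m n hmn l hl
      have h1 := (hNL n 1 (e.symm (e 1 * l))).2 (by simpa using hl)
      simpa using (hNL m 1 _).1 (hanti hmn h1)
    have hU' : (fun z => e.symm (e 1 * z)) ⁻¹' U ∈ 𝓝 (1 : X) :=
      (Continuous.tendsto' (by fun_prop) _ _ (by simp) :
        Tendsto (fun z => e.symm (e 1 * z)) (𝓝 1) (𝓝 1)) hU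
    obtain ⟨n, hn⟩ := h𝓛.exists_subset_mul L hantiL hL _ hU'
    refine ⟨n, fun y hy => ?_⟩
    obtain ⟨z, hz, l, hl, hzl⟩ := hn ((hNL n 1 y).1 (by simpa using hy))
    refine ⟨_, hz, (e.symm (e 1 * z))⁻¹ * y, Subgroup.mem_iInf.2 fun k => (hNL k _ _).2 ?_,
      mul_inv_cancel_left _ _⟩
    have : e y = e 1 * z * l := by rw [mul_assoc, show z * l = _ from hzl]; simp
    rw [this]
    simpa [mul_assoc] using Subgroup.mem_iInf.1 hl k

end homeomorph

/-! ### Extensions by compact normal subgroups -/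

section extension

variable {G : Type u} [Group G] [TopologicalSpace G] [IsTopologicalGroup G] [T2Space G]
  {K : Subgroup G} [K.Normal]

omit [TopologicalSpace G] [IsTopologicalGroup G] [T2Space G] in
theorem exists_mul_mul_of_mk_mem {V : Set G} {L : Subgroup G} {y : G}
    (hy : (y : G ⧸ K) ∈ (((↑) : G → G ⧸ K) '' V) *
      (L.map (QuotientGroup.mk' K) : Set (G ⧸ K))) :
    ∃ v ∈ V, ∃ k ∈ K, ∃ l ∈ L, y = v * k * l := by
  obtain ⟨_, ⟨v, hv, rfl⟩, _, ⟨l, hl, rfl⟩, h⟩ := hy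
  have hk : (v * l)⁻¹ * y ∈ K := QuotientGroup.eq.1 h
  refine ⟨v, hv, l * ((v * l)⁻¹ * y) * l⁻¹, Subgroup.Normal.conj_mem inferInstance _ hk l, l, hl,
    ?_⟩
  group

omit [T2Space G] in
theorem IsNarrow.of_quotient (hK : IsCompact (K : Set G)) (hQ : IsNarrow (G ⧸ K)) :
    IsNarrow G := by
  intro U hU
  obtain ⟨V, hV, hV1, hVU⟩ := exists_open_nhds_one_mul_subset hU
  -- `K` is covered by finitely many translates of `V`.
  obtain ⟨t, ht⟩ := hK.elim_nhds_subcover' (fun x _ => x • V)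
    fun x _ => (hV.smul x).mem_nhds ⟨1, hV1, mul_one x⟩
  obtain ⟨D, hD, hDV⟩ := hQ (((↑) : G → G ⧸ K) '' V)
    (QuotientGroup.isOpenMap_coe.image_mem_nhds (hV.mem_nhds hV1))
  refine ⟨Quotient.out '' D * (Subtype.val '' (t : Set K)),
    (hD.image _).image2 (t.countable_toSet.image _) _, eq_univ_of_forall fun x => ?_⟩
  obtain ⟨q, hq, _, ⟨v, hv, rfl⟩, h⟩ := hDV.ge (mem_univ (x : G ⧸ K))
  have hk : (q.out * v)⁻¹ * x ∈ K := by
    refine QuotientGroup.eq.1 ?_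
    rw [← h, QuotientGroup.mk_mul, QuotientGroup.out_eq']
  have hk' := Subgroup.Normal.conj_mem inferInstance _ hk v
  obtain ⟨a, ha, w, hw, haw⟩ := mem_iUnion₂.1 (ht hk')
  have haw' : (a : G) * w = v * ((q.out * v)⁻¹ * x) * v⁻¹ := haw
  refine ⟨_, mul_mem_mul (mem_image_of_mem _ hq) (mem_image_of_mem _ ha), w * v,
    hVU (mul_mem_mul hw hv), ?_⟩
  change q.out * a * (w * v) = x
  calc q.out * a * (w * v) = q.out * (a * w) * v := by group
    _ = x := by rw [haw']; group

/-- For a decreasing sequence of closed subgroups, intersections commute with taking the quotient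
by a compact normal subgroup. -/
theorem Subgroup.map_mk_iInf (hK : IsCompact (K : Set G)) {L : ℕ → Subgroup G} (hL : Antitone L)
    (hcl : ∀ n, IsClosed (L n : Set G)) :
    (⨅ n, L n).map (QuotientGroup.mk' K) = ⨅ n, (L n).map (QuotientGroup.mk' K) := by
  refine le_antisymm (le_iInf fun n => Subgroup.map_mono (iInf_le L n)) fun q hq => ?_
  obtain ⟨x, rfl⟩ := QuotientGroup.mk_surjective q
  have hcl' : ∀ n, IsClosed ((fun k => x * k) ⁻¹' (L n : Set G)) := fun n =>
    (hcl n).preimage (continuous_const_mul x)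
  obtain ⟨k, hk⟩ := IsCompact.nonempty_iInter_of_sequence_nonempty_isCompact_isClosed
    (fun n => (K : Set G) ∩ (fun k => x * k) ⁻¹' (L n : Set G))
    (fun n => inter_subset_inter_right _ (preimage_mono (hL n.le_succ)))
    (fun n => by
      obtain ⟨l, hl, hlx⟩ := Subgroup.mem_iInf.1 hq n
      exact ⟨x⁻¹ * l, QuotientGroup.eq.1 hlx.symm, by simpa using hl⟩)
    (hK.inter_right (hcl' 0)) (fun n => hK.isClosed.inter (hcl' n))
  have hkn := fun n => mem_iInter.1 hk n
  refine ⟨x * k, Subgroup.mem_iInf.2 fun n => (hkn n).2, ?_⟩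
  exact QuotientGroup.mk_mul_of_mem x (hkn 0).1

omit [T2Space G] in
/-- If `L` is the kernel of `φ : G → S`, then the compact cosets of `K` embed modulo `L` into `S`, so
the network sets modulo the image of `L` in `G ⧸ K`, cut by `φ`-preimages of basic open sets, form a
network modulo `L`. -/
theorem HasNetworkMod.of_map_mk (hK : IsCompact (K : Set G)) {L : Subgroup G}
    (hL : IsSecondCountableKernel L) (hnet : HasNetworkMod (L.map (QuotientGroup.mk' K))) :
    HasNetworkMod L := by
  obtain ⟨S, _, _, φ, _, _, _, hφ, rfl⟩ := hL
  obtain ⟨b, hbc, -, hb⟩ := TopologicalSpace.exists_countable_basis S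
  obtain ⟨N, hN, h⟩ := hnet
  refine ⟨image2 (fun A B => ((↑) : G → G ⧸ K) ⁻¹' A ∩ φ ⁻¹' B) N b, hN.image2 hbc _,
    fun x U hU hx => ?_⟩
  have hO : IsOpen (U * (φ.ker : Set G)) := hU.mul_right
  -- `φ x` is separated from the `φ`-image of the part of the coset `K x` outside `U * ker φ`.
  have hcomp :
      IsCompact (φ '' (((fun k => k * x) '' (K : Set G)) ∩ (U * (φ.ker : Set G))ᶜ)) :=
    ((hK.image (continuous_mul_const x)).inter_right hO.isClosed_compl).image hφ
  have hφx : φ x ∈ (φ '' (((fun k => k * x) '' (K : Set G)) ∩ (U * (φ.ker : Set G))ᶜ))ᶜ := by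
    rintro ⟨y, ⟨-, hy⟩, hyx⟩
    exact hy ⟨x, hx, x⁻¹ * y, by simp [MonoidHom.mem_ker, hyx], mul_inv_cancel_left x y⟩
  obtain ⟨C, hC, hCc, hCs⟩ :=
    exists_mem_nhds_isClosed_subset (hcomp.isClosed.isOpen_compl.mem_nhds hφx)
  obtain ⟨B, hB, hxB, hBC⟩ := hb.mem_nhds_iff.1 hC
  have hT : IsOpen (U * (φ.ker : Set G) ∪ φ ⁻¹' Cᶜ) := hO.union (hCc.isOpen_compl.preimage hφ)
  obtain ⟨V, hV, hVT⟩ := 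
    compact_open_separated_mul_left (hK.image (continuous_mul_const x)) hT <| by
    intro y hy
    by_cases hyU : y ∈ U * (φ.ker : Set G)
    · exact Or.inl hyU
    · exact Or.inr fun hyC => hCs hyC ⟨y, ⟨hy, hyU⟩, rfl⟩
  have hVo : IsOpen ((fun v => v * x) '' interior V) := isOpenMap_mul_right x _ isOpen_interior
  obtain ⟨A, hA, hxA, hAV⟩ := h x _ (QuotientGroup.isOpenMap_coe _ hVo)
    (mem_image_of_mem _ ⟨1, mem_interior_iff_mem_nhds.2 hV, one_mul x⟩)
  refine ⟨_, mem_image2_of_mem hA hB, ⟨hxA, hxB⟩, fun y hy => ?_⟩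
  obtain ⟨_, ⟨v, hv, rfl⟩, k, hk, l, hl, rfl⟩ := exists_mul_mul_of_mk_mem (hAV hy.1)
  have hvk : v * x * k ∈ U * (φ.ker : Set G) ∪ φ ⁻¹' Cᶜ := by
    refine hVT ⟨v, interior_subset hv, x * k, ⟨x * k * x⁻¹, ?_, ?_⟩, (mul_assoc v x k).symm⟩
    · exact Subgroup.Normal.conj_mem inferInstance k hk x
    · simp
  have hl' : φ l = 1 := hl
  have hyB : φ (v * x * k * l) ∈ B := hy.2
  rcases hvk with ⟨u, hu, m, hm, hum⟩ | hvk
  · refine ⟨u, hu, m * l, mul_mem hm hl, ?_⟩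
    have hum' : u * m = v * x * k := hum
    change u * (m * l) = _
    rw [← mul_assoc, hum']
  · rw [map_mul, hl', mul_one] at hyB
    exact absurd (hBC hyB) hvk

/-- Let `M` be the intersection of all `L n`. If no `L n` were contained in `U * M`, then, as
`L n` approaches `M` modulo `K`, the parts of the `L n` outside `U * M` would all meet `K`; by
compactness they would have a common point, which lies in `M`. -/
theorem exists_subset_mul_of_map_mk (hK : IsCompact (K : Set G)) {L : ℕ → Subgroup G}
    (hL : Antitone L) (hcl : ∀ n, IsClosed (L n : Set G))
    (hmap : ∀ U ∈ 𝓝 (1 : G ⧸ K), ∃ n, ((L n).map (QuotientGroup.mk' K) : Set (G ⧸ K)) ⊆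
      U * ((⨅ n, (L n).map (QuotientGroup.mk' K) : Subgroup (G ⧸ K)) : Set (G ⧸ K)))
    {U : Set G} (hU : U ∈ 𝓝 (1 : G)) :
    ∃ n, (L n : Set G) ⊆ U * ((⨅ n, L n : Subgroup G) : Set G) := by
  rw [← Subgroup.map_mk_iInf hK hL hcl] at hmap
  set M : Subgroup G := ⨅ n, L n with hM
  have hO : IsOpen (interior U * (M : Set G)) := isOpen_interior.mul_right
  suffices h : ∃ n, (L n : Set G) ⊆ interior U * (M : Set G) by
    obtain ⟨n, hn⟩ := h
    exact ⟨n, hn.trans (mul_subset_mul_right interior_subset)⟩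
  by_contra! hno
  have hFcl : ∀ n, IsClosed ((L n : Set G) ∩ (interior U * (M : Set G))ᶜ) := fun n =>
    (hcl n).inter hO.isClosed_compl
  have hne : ∀ n, ((K : Set G) ∩ ((L n : Set G) ∩ (interior U * (M : Set G))ᶜ)).Nonempty := by
    intro n
    by_contra hempty
    obtain ⟨W, hW, hWK⟩ := compact_open_separated_mul_left hK (hFcl n).isOpen_compl
      fun k hk hkF => hempty ⟨k, hk, hkF⟩
    obtain ⟨m, hm⟩ := hmap _ (QuotientGroup.isOpenMap_coe.image_mem_nhds hW)
    obtain ⟨y, hy, hyU⟩ := not_subset.1 (hno (max n m))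
    obtain ⟨w, hw, k, hk, l, hl, rfl⟩ := exists_mul_mul_of_mk_mem
      (hm (mem_image_of_mem _ (hL (le_max_right n m) hy)))
    refine hWK (mul_mem_mul hw hk) ⟨?_, ?_⟩
    · have := mul_mem (hL (le_max_left n m) hy) (inv_mem (Subgroup.mem_iInf.1 hl n))
      simpa using this
    · rintro ⟨u, hu, a, ha, hua⟩
      have hua' : u * a = w * k := hua
      refine hyU ⟨u, hu, a * l, mul_mem ha hl, ?_⟩
      change u * (a * l) = _
      rw [← mul_assoc, hua']
  obtain ⟨z, hz⟩ := IsCompact.nonempty_iInter_of_sequence_nonempty_isCompact_isClosed _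
    (fun n => inter_subset_inter_right _ (inter_subset_inter_left _ (hL n.le_succ))) hne
    (hK.inter_right (hFcl 0)) (fun n => hK.isClosed.inter (hFcl n))
  have hzn := fun n => mem_iInter.1 hz n
  exact (hzn 0).2.2 ⟨1, mem_interior_iff_mem_nhds.2 hU, z,
    Subgroup.mem_iInf.2 fun n => (hzn n).2.1, one_mul z⟩

/-- A lattice on the quotient by a compact normal subgroup `K` induces a lattice on `G`: its
members are the kernels of homomorphisms to second countable groups whose images in `G ⧸ K` belong
to the given lattice. Such kernels exist because images in `G ⧸ K` of kernels are again kernels, so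
that a decreasing sequence of kernels can be interlaced with members of the given lattice. -/
theorem IsCosmicLattice.of_quotient (hK : IsCompact (K : Set G)) {𝓛 : Set (Subgroup (G ⧸ K))}
    (h𝓛 : IsCosmicLattice 𝓛) :
    IsCosmicLattice {L : Subgroup G | IsSecondCountableKernel L ∧
      L.map (QuotientGroup.mk' K) ∈ 𝓛} where
  normal := fun L hL => hL.1.normal
  isClosed := fun L hL => hL.1.isClosed
  hasNetworkMod := fun L hL => .of_map_mk hK hL.1 (h𝓛.hasNetworkMod _ hL.2)
  exists_subset := by
    intro P hP h1
    have hG : IsNarrow G := .of_quotient hK h𝓛.isNarrow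
    obtain ⟨M₀, hM₀, hM₀P⟩ := hG.exists_isSecondCountableKernel_subset hP h1
    have hN : ∀ M : {M : Subgroup G // IsSecondCountableKernel M},
        ∃ N ∈ 𝓛, N ≤ M.1.map (QuotientGroup.mk' K) := fun M =>
      h𝓛.exists_subset _ (M.2.map_mk K hK).isGδ (one_mem _)
    choose N hN hNM using hN
    have hnext : ∀ M : {M : Subgroup G // IsSecondCountableKernel M},
        ∃ M' : {M : Subgroup G // IsSecondCountableKernel M},
          M'.1 ≤ M.1 ⊓ (N M).comap (QuotientGroup.mk' K) := by
      intro M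
      obtain ⟨M', hM', hle⟩ := hG.exists_isSecondCountableKernel_subset
        (P := (M.1 : Set G) ∩ QuotientGroup.mk' K ⁻¹' (N M : Set (G ⧸ K)))
        (M.2.isGδ.inter ((h𝓛.isGδ (hN M)).preimage QuotientGroup.continuous_mk))
        ⟨one_mem _, one_mem (N M)⟩
      exact ⟨⟨M', hM'⟩, hle⟩
    choose next hle using hnext
    let M : ℕ → {M : Subgroup G // IsSecondCountableKernel M} := fun n => next^[n] ⟨M₀, hM₀⟩
    have hsucc : ∀ n, M (n + 1) = next (M n) := fun n => Function.iterate_succ_apply' _ _ _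
    have hle' : ∀ n, (M (n + 1)).1 ≤ (M n).1 ⊓ (N (M n)).comap (QuotientGroup.mk' K) :=
      fun n => by rw [hsucc]; exact hle _
    have hanti : Antitone fun n => (M n).1 :=
      antitone_nat_of_succ_le fun n => (hle' n).trans inf_le_left
    have hMN : ∀ n, (M (n + 1)).1.map (QuotientGroup.mk' K) ≤ N (M n) := fun n =>
      Subgroup.map_le_iff_le_comap.2 ((hle' n).trans inf_le_right)
    refine ⟨⨅ n, (M n).1, ⟨.iInf fun n => (M n).2, ?_⟩, fun x hx =>
      hM₀P (Subgroup.mem_iInf.1 hx 0)⟩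
    rw [Subgroup.map_mk_iInf hK hanti fun n => (M n).2.isClosed]
    have : ⨅ n, (M n).1.map (QuotientGroup.mk' K) = ⨅ n, N (M n) :=
      le_antisymm (le_iInf fun n => (iInf_le _ (n + 1)).trans (hMN n))
        (iInf_mono fun n => hNM (M n))
    rw [this]
    exact h𝓛.iInf_mem _ (antitone_nat_of_succ_le fun n => (hNM _).trans (hMN n)) fun n => hN _
  iInf_mem := by
    intro L hanti hL
    refine ⟨.iInf fun n => (hL n).1, ?_⟩
    rw [Subgroup.map_mk_iInf hK hanti fun n => (hL n).1.isClosed]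
    exact h𝓛.iInf_mem _ (fun m n hmn => Subgroup.map_mono (hanti hmn)) fun n => (hL n).2
  exists_subset_mul := fun L hanti hL U hU =>
    exists_subset_mul_of_map_mk hK hanti (fun n => (hL n).1.isClosed)
      (h𝓛.exists_subset_mul _ (fun m n hmn => Subgroup.map_mono (hanti hmn)) fun n => (hL n).2) hU

end extension

theorem nonempty_homeomorph_quotient_ker_snd (C X : Type*) [Group C] [TopologicalSpace C]
    [Group X] [TopologicalSpace X] :
    Nonempty (((C × X) ⧸ (MonoidHom.snd C X).ker) ≃ₜ X) := by
  let q := QuotientGroup.quotientKerEquivOfSurjective (MonoidHom.snd C X) Prod.snd_surjective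
  refine ⟨q.toEquiv.toHomeomorphOfContinuousOpen ?_ ?_⟩
  · exact continuous_snd.quotient_lift _
  · intro U hU
    have h := isOpenMap_snd _ (hU.preimage (QuotientGroup.continuous_mk
      (N := (MonoidHom.snd C X).ker)))
    convert h using 1
    ext x
    constructor
    · rintro ⟨y, hy, rfl⟩
      obtain ⟨z, rfl⟩ := QuotientGroup.mk_surjective y
      exact ⟨z, hy, rfl⟩
    · rintro ⟨z, hz, rfl⟩
      exact ⟨z, hz, rfl⟩

theorem mainTheorem4 {G : Type*} [Group G] [TopologicalSpace G] [IsTopologicalGroup G] [T2Space G]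
    (K : Subgroup G) [K.Normal] (hK : IsCompact (K : Set G))
    {C : Type*} [Group C] [TopologicalSpace C] [IsTopologicalGroup C] [T2Space C] [CompactSpace C]
    {I : Type*} (H : I → Type*) [∀ i, Group (H i)] [∀ i, TopologicalSpace (H i)]
    [∀ i, IsTopologicalGroup (H i)] [∀ i, T2Space (H i)]
    (hH : ∀ i, HasCountableNetwork (H i))
    (hom : Nonempty ((G ⧸ K) ≃ₜ (C × (∀ i, H i)))) :
    IsRFactorizable G ∧ IsOmegaCellular G ∧
      (∀ P : Set G, IsGdeltaSigma P → IsZeroSet (closure P)) ∧ IsEfimov G := by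
  obtain ⟨e⟩ := hom
  obtain ⟨e'⟩ := nonempty_homeomorph_quotient_ker_snd C (∀ i, H i)
  have hC : IsCompact ((MonoidHom.snd C (∀ i, H i)).ker : Set (C × ∀ i, H i)) := by
    have : ((MonoidHom.snd C (∀ i, H i)).ker : Set (C × ∀ i, H i)) = univ ×ˢ {1} := by
      ext x
      simp only [SetLike.mem_coe, MonoidHom.mem_ker, MonoidHom.coe_snd, mem_prod, mem_univ,
        true_and, mem_singleton_iff]
    rw [this]
    exact isCompact_univ.prod isCompact_singleton
  have h := (((isCosmicLattice_pi hH).of_homeomorph e').of_quotient hC).of_homeomorph e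
    |>.of_quotient hK
  exact ⟨h.isRFactorizable, h.isOmegaCellular, fun P hP => h.isZeroSet_closure hP, h.isEfimov⟩
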